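/- Let $n\ge 1$. For a bit string $x=(x_1,\dots,x_n)\in\{0,1\}^n$ let $\hat x\in\{\pm1\}^n$ be the vector with $\hat x_k=1$ if $x_k=0$ and $\hat x_k=-1$ if $x_k=1$; let $|x\rangle$ be the corresponding standard basis state of $n$ qubits, and let $Z_1$ be the Pauli operator $Z=\mathrm{diag}(1,-1)$ acting on the first qubit. For $a\in\mathbb{R}^n$ put $\|a\|_1=\sum_k|a_k|$. A matchgate is a two-qubit gate which, in the ordered basis $|00\rangle,|01\rangle,|10\rangle,|11\rangle$, has the matrix $$\begin{pmatrix} A_{11}&0&0&A_{12}\\0&B_{11}&B_{12}&0\\0&B_{21}&B_{22}&0\\A_{21}&0&0&A_{22}\end{pmatrix},\qquad A,B\in SU(2).$$ An $n$-qubit matchgate circuit is a unitary operator on $n$ qubits that is a finite (possibly empty) product of matchgates, each acting on two neighbouring qubits $k,k+1$ with $1\le k<n$. (i) For every $n$-qubit matchgate circuit $U$ there is $a\in\mathbb{R}^n$ with $\|a\|_1\le 1$ such that $\langle x|U^\dagger Z_1U|x\rangle=a^T\hat x$ for every $x\in\{0,1\}^n$. (ii) Conversely, if $n\ge 2$, then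 for every $a\in\mathbb{R}^n$ with $\|a\|_1\le 1$ there is an $n$-qubit matchgate circuit $U$ such that $\langle x|U^\dagger Z_1U|x\rangle=a^T\hat x$ for every $x\in\{0,1\}^n$. -/

import Mathlib

open Matrix

namespace MatchgateLTG

/-- The `n`-bit strings; they label the standard basis of the state space of `n` qubits. Qubits are
numbered `0, …, n - 1`, so the first qubit has index `0`. -/
abbrev BitString (n : ℕ) : Type := Fin n → Fin 2

/-- Operators on `n` qubits, written as matrices in the standard basis. -/
abbrev QubitOp (n : ℕ) : Type := Matrix (BitString n) (BitString n) ℂ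

/-- The `±1` vector of a bit string: bits `0` become `1` and bits `1` become `-1`. -/
def signVec {n : ℕ} (x : BitString n) : Fin n → ℝ := fun k => if x k = 0 then 1 else -1

/-- The basis state `|x⟩`. -/
def ket {n : ℕ} (x : BitString n) : BitString n → ℂ := Pi.single x 1

/-- The matrix element `⟨x|O|x⟩`. -/
def diagElement {n : ℕ} (O : QubitOp n) (x : BitString n) : ℂ := star (ket x) ⬝ᵥ (O *ᵥ ket x)

/-- The one-qubit operator `M` acting on qubit `k`, the identity acting on the other qubits. -/
def onQubit {n : ℕ} (k : Fin n) (M : Matrix (Fin 2) (Fin 2) ℂ) : QubitOp n :=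
  Matrix.of fun x y => if ∀ j, j ≠ k → x j = y j then M (x k) (y k) else 0

/-- The Pauli operator `Z` on qubit `k`. -/
def pauliZ {n : ℕ} (k : Fin n) : QubitOp n := onQubit k !![1, 0; 0, -1]

/-- The two-qubit operator `M` acting on the qubits `p` and `q` (meant for `p ≠ q`), the identity
acting on the other qubits. -/
def onPair {n : ℕ} (p q : Fin n) (M : Matrix (Fin 2 × Fin 2) (Fin 2 × Fin 2) ℂ) : QubitOp n :=
  Matrix.of fun x y =>
    if ∀ j, j ≠ p → j ≠ q → x j = y j then M (x p, x q) (y p, y q) else 0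

/-- The matchgate `G(A, B)`: `A` acts on the span of `|00⟩, |11⟩` and `B` on the span of
`|01⟩, |10⟩`. The `4 × 4` matrix refers to the ordered basis `|00⟩, |01⟩, |10⟩, |11⟩`, which is the
order of `finProdFinEquiv : Fin 2 × Fin 2 ≃ Fin 4`. -/
def matchgate (A B : Matrix.specialUnitaryGroup (Fin 2) ℂ) :
    Matrix (Fin 2 × Fin 2) (Fin 2 × Fin 2) ℂ :=
  Matrix.submatrix
    !![A.1 0 0, 0,       0,       A.1 0 1;
       0,       B.1 0 0, B.1 0 1, 0;
       0,       B.1 1 0, B.1 1 1, 0;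
       A.1 1 0, 0,       0,       A.1 1 1]
    finProdFinEquiv finProdFinEquiv

/-- A gate of an `n`-qubit matchgate circuit: a matchgate `G(A, B)` placed on the neighbouring
qubits `site` and `site + 1`. -/
structure PlacedGate (n : ℕ) where
  /-- The first of the two neighbouring qubits. -/
  site : ℕ
  site_lt : site + 1 < n
  /-- The block on even-parity states. -/
  A : Matrix.specialUnitaryGroup (Fin 2) ℂ
  /-- The block on odd-parity states. -/
  B : Matrix.specialUnitaryGroup (Fin 2) ℂ

/-- The `n`-qubit operator of a placed gate. -/
def PlacedGate.toOp {n : ℕ} (g : PlacedGate n) : QubitOp n :=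
  onPair ⟨g.site, Nat.lt_of_succ_lt g.site_lt⟩ ⟨g.site + 1, g.site_lt⟩ (matchgate g.A g.B)

/-- `U` is the operator of a nearest-neighbour matchgate circuit: a product of finitely many
placed gates (the last gate of the list is applied first). -/
def IsMatchgateCircuit {n : ℕ} (U : QubitOp n) : Prop :=
  ∃ gates : List (PlacedGate n), U = (gates.map PlacedGate.toOp).prod

end MatchgateLTG

/-! By Jordan–Wigner, the operators `majorana z` are the real combinations of the 2n Majorana
operators, with `Re (z k)` and `Im (z k)` multiplying the strings Z…ZX and Z…ZY that end at qubit
`k`. Conjugation by a matchgate circuit preserves this real space (`onPair_conj_majorana`) and, by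
invariance of the trace, its Euclidean inner product (`sum_re_eq_of_conj`).

Since XY = iZ on the first qubit, the conjugated Z₁ is −i times a product of two orthonormal
combinations `z`, `w`. Its diagonal is linear in the signs, with coefficients Im(conj(z_k) w_k)
(`majorana_mul_majorana_diag`), and AM–GM bounds the sum of their absolute values by 1.

Conversely, `a` is the coordinatewise product of real unit vectors `x` and `y`
(`exists_unit_factorization`). A chain of neighbouring rotations sends X₁ to the X-type combination
`x` and Y₁ to the Y-type combination `y` (`reachable_of_unit`). These are orthogonal automatically
and give the coefficients x_k y_k = a_k. -/

namespace MatchgateLTG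

open scoped Kronecker

/-! ### Tensor products and operators on two qubits -/

/-- The tensor product of one-qubit operators. -/
def tensorOp {n : ℕ} (M : Fin n → Matrix (Fin 2) (Fin 2) ℂ) : QubitOp n :=
  Matrix.of fun x y => ∏ j, M j (x j) (y j)

theorem tensorOp_mul {n : ℕ} (M N : Fin n → Matrix (Fin 2) (Fin 2) ℂ) :
    tensorOp M * tensorOp N = tensorOp (fun j => M j * N j) := by
  ext x z
  simp only [tensorOp, Matrix.mul_apply, Matrix.of_apply, ← Finset.prod_mul_distrib]
  rw [Finset.prod_univ_sum, Fintype.piFinset_univ]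

theorem tensorOp_one {n : ℕ} : tensorOp (fun _ : Fin n => 1) = 1 := by
  ext x y
  simp only [tensorOp, Matrix.of_apply, Matrix.one_apply, Finset.prod_ite_zero, funext_iff]
  simp

theorem onPair_kronecker {n : ℕ} {p q : Fin n} (hpq : p ≠ q) (A B : Matrix (Fin 2) (Fin 2) ℂ) :
    onPair p q (A ⊗ₖ B) = tensorOp (fun j => if j = p then A else if j = q then B else 1) := by
  ext x y
  simp only [onPair, tensorOp, Matrix.of_apply, kroneckerMap_apply]
  rw [← Finset.mul_prod_erase _ _ (Finset.mem_univ p),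
    ← Finset.mul_prod_erase (Finset.univ.erase p) _ (by simpa using hpq.symm : q ∈ _)]
  have : ∏ j ∈ (Finset.univ.erase p).erase q,
      (if j = p then A else if j = q then B else 1) (x j) (y j) =
      ∏ j ∈ (Finset.univ.erase p).erase q, if x j = y j then (1 : ℂ) else 0 := by
    refine Finset.prod_congr rfl fun j hj => ?_
    simp only [Finset.mem_erase] at hj
    rw [if_neg hj.2.1, if_neg hj.1, Matrix.one_apply]
  rw [this, Finset.prod_ite_zero]
  simp only [Finset.mem_erase, Finset.mem_univ, and_true, if_true, if_neg hpq.symm]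
  by_cases h : ∀ j, j ≠ p → j ≠ q → x j = y j
  · rw [if_pos h, if_pos fun j hj => h j hj.2 hj.1]; simp
  · rw [if_neg h, if_neg fun h' => h fun j hp hq => h' j ⟨hq, hp⟩]; simp

theorem onPair_add {n : ℕ} (p q : Fin n) (M N : Matrix (Fin 2 × Fin 2) (Fin 2 × Fin 2) ℂ) :
    onPair p q (M + N) = onPair p q M + onPair p q N := by
  ext x y
  simp only [onPair, Matrix.of_apply, Matrix.add_apply]
  split_ifs <;> simp

theorem onPair_zero {n : ℕ} (p q : Fin n) : onPair p q 0 = 0 := by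
  ext x y
  simp [onPair]

theorem onPair_conjTranspose {n : ℕ} (p q : Fin n)
    (M : Matrix (Fin 2 × Fin 2) (Fin 2 × Fin 2) ℂ) :
    onPair p q Mᴴ = (onPair p q M)ᴴ := by
  ext x y
  simp only [onPair, Matrix.of_apply, Matrix.conjTranspose_apply, eq_comm]
  split_ifs <;> simp

/-- Operators on two qubits are sums of tensor products. -/
theorem kronecker_induction {P : Matrix (Fin 2 × Fin 2) (Fin 2 × Fin 2) ℂ → Prop}
    (M : Matrix (Fin 2 × Fin 2) (Fin 2 × Fin 2) ℂ) (zero : P 0)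
    (add : ∀ M N, P M → P N → P (M + N)) (kron : ∀ A B, P (A ⊗ₖ B)) : P M := by
  refine Matrix.induction_on' M zero (fun M N => add M N) fun i j c => ?_
  have := kron (Matrix.single i.1 j.1 c) (Matrix.single i.2 j.2 1)
  rwa [Matrix.single_kronecker_single, mul_one] at this

theorem onPair_mul {n : ℕ} {p q : Fin n} (hpq : p ≠ q)
    (M N : Matrix (Fin 2 × Fin 2) (Fin 2 × Fin 2) ℂ) :
    onPair p q (M * N) = onPair p q M * onPair p q N := by
  induction M using kronecker_induction with
  | zero => simp [onPair_zero]
  | add M M' h h' => simp only [add_mul, onPair_add, h, h']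
  | kron A B =>
    induction N using kronecker_induction with
    | zero => simp [onPair_zero]
    | add M M' h h' => simp only [mul_add, onPair_add, h, h']
    | kron C D =>
      rw [← Matrix.mul_kronecker_mul, onPair_kronecker hpq, onPair_kronecker hpq,
        onPair_kronecker hpq, tensorOp_mul]
      congr 1
      funext j
      split_ifs <;> simp

theorem onPair_one {n : ℕ} {p q : Fin n} (hpq : p ≠ q) : onPair p q 1 = 1 := by
  rw [← Matrix.one_kronecker_one, onPair_kronecker hpq, ← tensorOp_one]
  simp

theorem tensorOp_commute_onPair {n : ℕ} {p q : Fin n} (hpq : p ≠ q)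
    {C : Fin n → Matrix (Fin 2) (Fin 2) ℂ} (hp : C p = 1) (hq : C q = 1)
    (M : Matrix (Fin 2 × Fin 2) (Fin 2 × Fin 2) ℂ) :
    tensorOp C * onPair p q M = onPair p q M * tensorOp C := by
  induction M using kronecker_induction with
  | zero => simp [onPair_zero]
  | add M M' h h' => simp only [mul_add, add_mul, onPair_add, h, h']
  | kron A B =>
    rw [onPair_kronecker hpq, tensorOp_mul, tensorOp_mul]
    congr 1
    funext j
    split_ifs with h1 h2
    · simp [h1, hp]
    · simp [h2, hq]
    · simp

/-- A tensor product splits into its factors on a pair of qubits and the others. -/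
theorem tensorOp_eq_mul_onPair {n : ℕ} {p q : Fin n} (hpq : p ≠ q)
    (M C : Fin n → Matrix (Fin 2) (Fin 2) ℂ) (hp : C p = 1) (hq : C q = 1)
    (h : ∀ j, j ≠ p → j ≠ q → C j = M j) :
    tensorOp M = tensorOp C * onPair p q (M p ⊗ₖ M q) := by
  rw [onPair_kronecker hpq, tensorOp_mul]
  congr 1
  funext j
  split_ifs with h1 h2
  · simp [h1, hp]
  · simp [h2, hq]
  · simp [h j h1 h2]

/-! ### Action of matchgates on Majorana operators -/

/-- The diagonal Pauli matrix. -/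
def sigmaZ : Matrix (Fin 2) (Fin 2) ℂ := !![1, 0; 0, -1]

/-- The combination `x X + y Y` of Pauli matrices, for `z = x + i y`. -/
def sigmaXY (z : ℂ) : Matrix (Fin 2) (Fin 2) ℂ := !![0, star z; z, 0]

/-- The Jordan–Wigner combination of the two Majorana operators of qubit `k`. -/
def majoranaAt {n : ℕ} (k : Fin n) (z : ℂ) : QubitOp n :=
  tensorOp fun j => if j < k then sigmaZ else if j = k then sigmaXY z else 1

/-- The real linear combination of Majorana operators whose coefficients at qubit `k` are the real
and imaginary part of `z k`. -/
def majorana {n : ℕ} (z : Fin n → ℂ) : QubitOp n := ∑ k, majoranaAt k (z k)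

/-- The real linear combinations of the Majorana operators of a pair of qubits. -/
def pairMajorana (z w : ℂ) : Matrix (Fin 2 × Fin 2) (Fin 2 × Fin 2) ℂ :=
  sigmaXY z ⊗ₖ 1 + sigmaZ ⊗ₖ sigmaXY w

theorem matchgate_apply (A B : Matrix.specialUnitaryGroup (Fin 2) ℂ) (x y : Fin 2 × Fin 2) :
    matchgate A B x y =
      if x.1 = x.2 then (if y.1 = y.2 then A.1 x.1 y.1 else 0)
      else (if y.1 = y.2 then 0 else B.1 x.1 y.1) := by
  obtain ⟨a, b⟩ := x
  obtain ⟨c, d⟩ := y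
  fin_cases a <;> fin_cases b <;> fin_cases c <;> fin_cases d <;> simp <;> rfl

/-- For determinant 1 the inverse is the adjugate; for a unitary matrix it is the adjoint. -/
theorem specialUnitary_entries (A : Matrix.specialUnitaryGroup (Fin 2) ℂ) :
    A.1 1 1 = star (A.1 0 0) ∧ A.1 1 0 = -star (A.1 0 1) ∧
      A.1 0 0 * star (A.1 0 0) + A.1 0 1 * star (A.1 0 1) = 1 := by
  obtain ⟨A, hA⟩ := A
  rw [Matrix.mem_specialUnitaryGroup_iff] at hA
  obtain ⟨hU, hdet⟩ := hA
  have h1 := Matrix.mem_unitaryGroup_iff'.1 hU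
  have h2 := Matrix.mem_unitaryGroup_iff.1 hU
  have h3 : star A = A.adjugate := by
    have : A * A.adjugate = 1 := by rw [Matrix.mul_adjugate, hdet, one_smul]
    calc star A = star A * (A * A.adjugate) := by rw [this, mul_one]
      _ = A.adjugate := by rw [← mul_assoc, h1, one_mul]
  rw [Matrix.adjugate_fin_two] at h3
  have e00 := congrFun₂ h3 0 0
  have e10 := congrFun₂ h3 1 0
  have f := congrFun₂ h2 0 0
  simp [Matrix.star_apply, Matrix.mul_apply, Fin.sum_univ_two] at e00 e10 f
  refine ⟨e00.symm, ?_, by simpa using f⟩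
  simp [e10]

theorem matchgate_unitary (A B : Matrix.specialUnitaryGroup (Fin 2) ℂ) :
    (matchgate A B)ᴴ * matchgate A B = 1 := by
  obtain ⟨a1, a2, a3⟩ := specialUnitary_entries A
  obtain ⟨b1, b2, b3⟩ := specialUnitary_entries B
  ext ⟨a, b⟩ ⟨c, d⟩
  fin_cases a <;> fin_cases b <;> fin_cases c <;> fin_cases d <;>
    simp [Matrix.mul_apply, Fintype.sum_prod_type, matchgate_apply, a1, a2, b1, b2] <;>
    simp at a3 b3 <;> first | ring1 | linear_combination a3 | linear_combination b3

/-- `pairMajorana` exchanges the two parity sectors. Up to a fixed factor diag(1, −1), its block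
between them is a quaternion, on which `A` and `B` act by multiplication from the two sides: this is
SU(2) × SU(2) acting on ℝ⁴. -/
theorem matchgate_conj_pairMajorana (A B : Matrix.specialUnitaryGroup (Fin 2) ℂ) (z w : ℂ) :
    (matchgate A B)ᴴ * pairMajorana z w * matchgate A B =
      pairMajorana
        (star (A.1 0 1) * (star w * B.1 0 0 - star z * star (B.1 0 1)) +
          A.1 0 0 * (z * B.1 0 0 + w * star (B.1 0 1)))
        (A.1 0 0 * (w * star (B.1 0 0) - z * B.1 0 1) -
          star (A.1 0 1) * (star z * star (B.1 0 0) + star w * B.1 0 1)) := by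
  obtain ⟨a1, a2, a3⟩ := specialUnitary_entries A
  obtain ⟨b1, b2, b3⟩ := specialUnitary_entries B
  ext ⟨a, b⟩ ⟨c, d⟩
  fin_cases a <;> fin_cases b <;> fin_cases c <;> fin_cases d <;>
    simp [Matrix.mul_apply, Fintype.sum_prod_type, matchgate_apply, a1, a2, b1, b2, pairMajorana, sigmaXY, sigmaZ] <;> try ring

theorem onPair_conj_tensorOp {n : ℕ} {p q : Fin n} (hpq : p ≠ q)
    {C : Fin n → Matrix (Fin 2) (Fin 2) ℂ} (hp : C p = 1) (hq : C q = 1)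
    (G M : Matrix (Fin 2 × Fin 2) (Fin 2 × Fin 2) ℂ) :
    (onPair p q G)ᴴ * (tensorOp C * onPair p q M) * onPair p q G =
      tensorOp C * onPair p q (Gᴴ * M * G) := by
  rw [onPair_mul hpq, onPair_mul hpq, onPair_conjTranspose, ← onPair_conjTranspose,
    ← mul_assoc, ← tensorOp_commute_onPair hpq hp hq]
  simp only [mul_assoc]

theorem matchgate_commute_parity (A B : Matrix.specialUnitaryGroup (Fin 2) ℂ) :
    (matchgate A B)ᴴ * (sigmaZ ⊗ₖ sigmaZ) * matchgate A B = sigmaZ ⊗ₖ sigmaZ := by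
  have h : (sigmaZ ⊗ₖ sigmaZ) * matchgate A B = matchgate A B * (sigmaZ ⊗ₖ sigmaZ) := by
    ext ⟨a, b⟩ ⟨c, d⟩
    fin_cases a <;> fin_cases b <;> fin_cases c <;> fin_cases d <;>
      simp [Matrix.mul_apply, Fintype.sum_prod_type, matchgate_apply, sigmaZ]
  rw [mul_assoc, h, ← mul_assoc, matchgate_unitary, one_mul]

theorem sum_eq_add_add_sum_erase {ι M : Type*} [Fintype ι] [DecidableEq ι] [AddCommMonoid M]
    {p q : ι} (hpq : p ≠ q) (F : ι → M) :
    ∑ k, F k = F p + F q + ∑ k ∈ (Finset.univ.erase p).erase q, F k := by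
  rw [← Finset.add_sum_erase _ _ (Finset.mem_univ p),
    ← Finset.add_sum_erase (Finset.univ.erase p) _ (by simpa using hpq.symm : q ∈ _), add_assoc]

/-- Conjugation by a matchgate on neighbouring qubits maps Majorana operators to Majorana
operators. -/
theorem onPair_conj_majorana {n : ℕ} {p q : Fin n} (hpq : (q : ℕ) = p + 1)
    (A B : Matrix.specialUnitaryGroup (Fin 2) ℂ) (z z' : Fin n → ℂ)
    (hz : ∀ k, k ≠ p → k ≠ q → z' k = z k)
    (h : (matchgate A B)ᴴ * pairMajorana (z p) (z q) * matchgate A B =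
      pairMajorana (z' p) (z' q)) :
    (onPair p q (matchgate A B))ᴴ * majorana z * onPair p q (matchgate A B) = majorana z' := by
  have hlt : p < q := by rw [Fin.lt_def]; omega
  have hne : p ≠ q := hlt.ne
  have pair : ∀ u : Fin n → ℂ, majoranaAt p (u p) + majoranaAt q (u q) =
      tensorOp (fun j => if j < p then sigmaZ else 1) *
        onPair p q (pairMajorana (u p) (u q)) := by
    intro u
    rw [pairMajorana, onPair_add, mul_add, majoranaAt, majoranaAt]
    congr 1
    · rw [tensorOp_eq_mul_onPair hne _ (fun j => if j < p then sigmaZ else 1) (by simp)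
        (by simp [hlt.not_gt])]
      · simp [hlt.not_gt, hne.symm]
      · intro j h1 h2
        simp [h1]
    · rw [tensorOp_eq_mul_onPair hne _ (fun j => if j < p then sigmaZ else 1) (by simp)
        (by simp [hlt.not_gt])]
      · simp [hlt]
      · intro j h1 h2
        have : j < q ↔ j < p := by
          rw [Fin.lt_def, Fin.lt_def]
          have : (j : ℕ) ≠ p := fun h => h1 (Fin.ext h)
          omega
        simp [h2, this]
  have other : ∀ k, k ≠ p → k ≠ q →
      (onPair p q (matchgate A B))ᴴ * majoranaAt k (z k) * onPair p q (matchgate A B) =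
        majoranaAt k (z k) := by
    intro k h1 h2
    -- The string is trivial on the pair if it ends before `p`; if it ends after `q`, it is the
    -- parity Z ⊗ Z there, which commutes with matchgates.
    have key : majoranaAt k (z k) = tensorOp (fun j => if j = p ∨ j = q then 1 else
        if j < k then sigmaZ else if j = k then sigmaXY (z k) else 1) *
          onPair p q (if k < p then 1 else sigmaZ ⊗ₖ sigmaZ) := by
      rw [majoranaAt, tensorOp_eq_mul_onPair hne _ (fun j => if j = p ∨ j = q then 1 else
        if j < k then sigmaZ else if j = k then sigmaXY (z k) else 1) (by simp) (by simp)]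
      · congr 2
        split_ifs <;> first | rfl | (simp; done) | (exfalso; simp only [Fin.lt_def, Fin.ext_iff] at *; omega)
      · intro j h1 h2
        simp [h1, h2]
    rw [key, onPair_conj_tensorOp hne (by simp) (by simp)]
    congr 2
    split_ifs
    · rw [mul_one, matchgate_unitary]
    · exact matchgate_commute_parity A B
  rw [majorana, majorana, sum_eq_add_add_sum_erase hne, sum_eq_add_add_sum_erase hne, pair z, pair z', mul_add, add_mul,
    onPair_conj_tensorOp hne (by simp) (by simp [hlt.not_gt]), h, Finset.mul_sum, Finset.sum_mul]
  congr 1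
  refine Finset.sum_congr rfl fun k hk => ?_
  simp only [Finset.mem_erase] at hk
  rw [other k hk.2.1 hk.1, hz k hk.2.1 hk.1]

/-! ### Diagonals of products of Majorana operators -/

theorem sigmaZ_mul_sigmaZ : sigmaZ * sigmaZ = 1 := by
  ext i j
  fin_cases i <;> fin_cases j <;> simp [sigmaZ]

theorem sigmaXY_apply_self (z : ℂ) (b : Fin 2) : sigmaXY z b b = 0 := by
  fin_cases b <;> simp [sigmaXY]

theorem sigmaXY_mul_sigmaZ_apply_self (z : ℂ) (b : Fin 2) : (sigmaXY z * sigmaZ) b b = 0 := by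
  fin_cases b <;> simp [sigmaXY, sigmaZ]

theorem sigmaXY_mul_sigmaXY_apply_self (z w : ℂ) (b : Fin 2) :
    (sigmaXY z * sigmaXY w) b b = (star z * w).re +
      Complex.I * (star z * w).im * ((if b = 0 then 1 else -1 : ℝ) : ℂ) := by
  fin_cases b <;> simp [sigmaXY, Complex.ext_iff]
  ring

/-- The diagonal of a product of two combinations of Majorana operators. -/
theorem majorana_mul_majorana_diag {n : ℕ} (z w : Fin n → ℂ) (x : BitString n) :
    (majorana z * majorana w) x x =
      ∑ k, ((star (z k) * w k).re + Complex.I * (star (z k) * w k).im * signVec x k) := by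
  have cross : ∀ k l, (majoranaAt k (z k) * majoranaAt l (w l)) x x =
      if l = k then ((star (z k) * w k).re + Complex.I * (star (z k) * w k).im * signVec x k : ℂ)
      else 0 := by
    intro k l
    rw [majoranaAt, majoranaAt, tensorOp_mul, tensorOp, Matrix.of_apply]
    split_ifs with h
    · subst h
      rw [Finset.prod_eq_single_of_mem l (Finset.mem_univ l)]
      · simpa [signVec] using sigmaXY_mul_sigmaXY_apply_self (z l) (w l) (x l)
      · intro j _ hj
        by_cases hlt : j < l <;> simp [hj, hlt, sigmaZ_mul_sigmaZ]
    -- For distinct end qubits, the factor at the smaller one has zero diagonal.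
    · rcases lt_or_gt_of_ne h with h | h
      · refine Finset.prod_eq_zero (Finset.mem_univ k) ?_
        simp [h.not_gt, h.ne', sigmaXY_apply_self]
      · refine Finset.prod_eq_zero (Finset.mem_univ k) ?_
        simp [h, sigmaXY_mul_sigmaZ_apply_self]
  rw [majorana, majorana, Finset.sum_mul_sum, Matrix.sum_apply]
  refine Finset.sum_congr rfl fun k _ => ?_
  rw [Matrix.sum_apply]
  simp [cross]

theorem onQubit_eq_tensorOp {n : ℕ} (k : Fin n) (M : Matrix (Fin 2) (Fin 2) ℂ) :
    onQubit k M = tensorOp (fun j => if j = k then M else 1) := by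
  ext x y
  simp only [onQubit, tensorOp, Matrix.of_apply]
  rw [← Finset.mul_prod_erase _ _ (Finset.mem_univ k)]
  have : ∏ j ∈ Finset.univ.erase k, (if j = k then M else 1) (x j) (y j) =
      ∏ j ∈ Finset.univ.erase k, if x j = y j then (1 : ℂ) else 0 := by
    refine Finset.prod_congr rfl fun j hj => ?_
    rw [if_neg (Finset.ne_of_mem_erase hj), Matrix.one_apply]
  rw [this, Finset.prod_ite_zero]
  simp

theorem majorana_single {n : ℕ} (k : Fin n) (z : ℂ) :
    majorana (Pi.single k z) = majoranaAt k z := by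
  rw [majorana, Finset.sum_eq_single k, Pi.single_eq_same]
  · intro j _ hj
    rw [Pi.single_eq_of_ne hj]
    ext x y
    rw [majoranaAt, tensorOp, Matrix.of_apply]
    refine Finset.prod_eq_zero (Finset.mem_univ j) ?_
    have : sigmaXY 0 = 0 := by
      ext a b
      fin_cases a <;> fin_cases b <;> simp [sigmaXY]
    simp [this]
  · simp

/-- The Pauli operator `Z` on the first qubit as a product of two Majorana operators. -/
theorem majorana_mul_majorana_eq_pauliZ {n : ℕ} (hn : 0 < n) :
    majorana (Pi.single ⟨0, hn⟩ 1) * majorana (Pi.single ⟨0, hn⟩ Complex.I) =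
      Complex.I • pauliZ ⟨0, hn⟩ := by
  have h : sigmaXY 1 * sigmaXY Complex.I = Complex.I • !![1, 0; 0, -1] := by
    ext a b
    fin_cases a <;> fin_cases b <;> simp [sigmaXY]
  have h' : Complex.I • pauliZ ⟨0, hn⟩ = onQubit ⟨0, hn⟩ (sigmaXY 1 * sigmaXY Complex.I) := by
    rw [h]
    ext x y
    simp only [pauliZ, onQubit, Matrix.of_apply, Matrix.smul_apply]
    split_ifs <;> simp
  rw [h', onQubit_eq_tensorOp, majorana_single, majorana_single, majoranaAt, majoranaAt,
    tensorOp_mul]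
  congr 1
  funext j
  have : ¬ j < ⟨0, hn⟩ := by simp [Fin.lt_def]
  simp only [this, if_false]
  split_ifs <;> simp

/-! ### Invariance of the inner product and the ℓ¹ bound -/

theorem diagElement_eq {n : ℕ} (O : QubitOp n) (x : BitString n) : diagElement O x = O x x := by
  simp [diagElement, ket]

theorem PlacedGate.toOp_unitary {n : ℕ} (g : PlacedGate n) : (g.toOp)ᴴ * g.toOp = 1 := by
  have hne : (⟨g.site, Nat.lt_of_succ_lt g.site_lt⟩ : Fin n) ≠ ⟨g.site + 1, g.site_lt⟩ := by
    simp [Fin.ext_iff]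
  rw [PlacedGate.toOp, ← onPair_conjTranspose, ← onPair_mul hne, matchgate_unitary,
    onPair_one hne]

/-- A gate maps Majorana operators to Majorana operators. -/
theorem PlacedGate.exists_conj_majorana {n : ℕ} (g : PlacedGate n) (z : Fin n → ℂ) :
    ∃ z', (g.toOp)ᴴ * majorana z * g.toOp = majorana z' := by
  let p : Fin n := ⟨g.site, Nat.lt_of_succ_lt g.site_lt⟩
  let q : Fin n := ⟨g.site + 1, g.site_lt⟩
  have hne : p ≠ q := by simp [p, q, Fin.ext_iff]
  obtain ⟨u, v, huv⟩ : ∃ u v, (matchgate g.A g.B)ᴴ * pairMajorana (z p) (z q) * matchgate g.A g.B =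
      pairMajorana u v := ⟨_, _, matchgate_conj_pairMajorana g.A g.B (z p) (z q)⟩
  refine ⟨Function.update (Function.update z p u) q v,
    onPair_conj_majorana (p := p) (q := q) rfl g.A g.B z _ (fun k hp hq => ?_) ?_⟩
  · rw [Function.update_of_ne hq, Function.update_of_ne hp]
  · rw [Function.update_self, Function.update_of_ne hne, Function.update_self, huv]

theorem IsMatchgateCircuit.exists_conj_majorana {n : ℕ} {U : QubitOp n}
    (hU : IsMatchgateCircuit U) (z : Fin n → ℂ) : ∃ z', Uᴴ * majorana z * U = majorana z' := by
  obtain ⟨gates, rfl⟩ := hU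
  induction gates generalizing z with
  | nil => exact ⟨z, by simp⟩
  | cons g gates ih =>
    obtain ⟨z₁, h₁⟩ := g.exists_conj_majorana z
    obtain ⟨z₂, h₂⟩ := ih z₁
    refine ⟨z₂, ?_⟩
    rw [← h₂, ← h₁, List.map_cons, List.prod_cons, Matrix.conjTranspose_mul]
    simp only [mul_assoc]

theorem re_trace_majorana_mul_majorana {n : ℕ} (z w : Fin n → ℂ) :
    (majorana z * majorana w).trace.re = 2 ^ n * ∑ k, (star (z k) * w k).re := by
  have h : ∀ x : BitString n,
      ((majorana z * majorana w) x x).re = ∑ k, (star (z k) * w k).re := by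
    intro x
    rw [majorana_mul_majorana_diag, Complex.re_sum]
    refine Finset.sum_congr rfl fun k _ => ?_
    rw [Complex.add_re, Complex.ofReal_re, mul_assoc, ← Complex.ofReal_mul,
      Complex.re_mul_ofReal, Complex.I_re, zero_mul, add_zero]
  simp only [Matrix.trace, Matrix.diag, Complex.re_sum, h]
  simp

theorem conj_mul_conj {n : ℕ} {U : QubitOp n} (hU : U * Uᴴ = 1) (M N : QubitOp n) :
    (Uᴴ * M * U) * (Uᴴ * N * U) = Uᴴ * (M * N) * U := by
  calc (Uᴴ * M * U) * (Uᴴ * N * U) = Uᴴ * M * (U * Uᴴ) * N * U := by simp only [mul_assoc]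
    _ = Uᴴ * (M * N) * U := by rw [hU]; simp only [mul_assoc, mul_one]

/-- Unitary conjugation preserves the real inner product of coefficient vectors. -/
theorem sum_re_eq_of_conj {n : ℕ} {U : QubitOp n} (hU : U * Uᴴ = 1) {z w z' w' : Fin n → ℂ}
    (hz : Uᴴ * majorana z * U = majorana z') (hw : Uᴴ * majorana w * U = majorana w') :
    ∑ k, (star (z' k) * w' k).re = ∑ k, (star (z k) * w k).re := by
  have h : (majorana z' * majorana w').trace = (majorana z * majorana w).trace := by
    rw [← hz, ← hw, conj_mul_conj hU, Matrix.trace_mul_comm, ← mul_assoc, hU, one_mul]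
  have := re_trace_majorana_mul_majorana z' w'
  rw [h, re_trace_majorana_mul_majorana] at this
  exact (mul_left_cancel₀ (by positivity) this).symm

/-- Orthogonality of `z` and `w` removes the constant term of the diagonal, leaving the part linear
in the signs. -/
theorem diagElement_conj_pauliZ {n : ℕ} (hn : 0 < n) {U : QubitOp n} (hU : U * Uᴴ = 1)
    {z w : Fin n → ℂ} (hz : Uᴴ * majorana (Pi.single ⟨0, hn⟩ 1) * U = majorana z)
    (hw : Uᴴ * majorana (Pi.single ⟨0, hn⟩ Complex.I) * U = majorana w)
    (hzw : ∑ k, (star (z k) * w k).re = 0) (x : BitString n) :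
    diagElement (Uᴴ * pauliZ ⟨0, hn⟩ * U) x =
      (((fun k => (star (z k) * w k).im) ⬝ᵥ signVec x : ℝ) : ℂ) := by
  have h : Complex.I • (Uᴴ * pauliZ ⟨0, hn⟩ * U) = majorana z * majorana w := by
    rw [← hz, ← hw, conj_mul_conj hU, majorana_mul_majorana_eq_pauliZ, Matrix.mul_smul,
      Matrix.smul_mul]
  have h' := congrFun₂ h x x
  rw [majorana_mul_majorana_diag, Finset.sum_add_distrib, ← Complex.ofReal_sum, hzw,
    Matrix.smul_apply, smul_eq_mul] at h'
  rw [diagElement_eq]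
  refine mul_left_cancel₀ Complex.I_ne_zero (h'.trans ?_)
  simp only [Complex.ofReal_zero, zero_add, mul_assoc, ← Finset.mul_sum]
  simp [dotProduct]

theorem sum_abs_im_le_one {n : ℕ} {z w : Fin n → ℂ} (hz : ∑ k, (star (z k) * z k).re = 1)
    (hw : ∑ k, (star (w k) * w k).re = 1) : ∑ k, |(star (z k) * w k).im| ≤ 1 := by
  have h : ∀ u : ℂ, (star u * u).re = ‖u‖ ^ 2 := by
    intro u
    rw [← Complex.normSq_eq_norm_sq, Complex.normSq_apply]
    simp
  simp only [h] at hz hw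
  calc ∑ k, |(star (z k) * w k).im| ≤ ∑ k, (‖z k‖ ^ 2 + ‖w k‖ ^ 2) / 2 := by
        refine Finset.sum_le_sum fun k _ => ?_
        have h1 := Complex.abs_im_le_norm (star (z k) * w k)
        rw [norm_mul, norm_star] at h1
        nlinarith [sq_nonneg (‖z k‖ - ‖w k‖)]
    _ = 1 := by rw [← Finset.sum_div, Finset.sum_add_distrib, hz, hw]; norm_num

/-! ### Reaching pairs of unit vectors by rotations -/

/-- The plane rotation as an element of the special unitary group. -/
noncomputable def rotation (t : ℝ) : Matrix.specialUnitaryGroup (Fin 2) ℂ :=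
  ⟨!![(Real.cos t : ℂ), -(Real.sin t : ℂ); (Real.sin t : ℂ), (Real.cos t : ℂ)], by
    have h : (Real.cos t : ℂ) * Real.cos t + (Real.sin t : ℂ) * Real.sin t = 1 := by
      rw [← Complex.ofReal_mul, ← Complex.ofReal_mul, ← Complex.ofReal_add, ← sq, ← sq,
        Real.cos_sq_add_sin_sq, Complex.ofReal_one]
    rw [Matrix.mem_specialUnitaryGroup_iff, Matrix.mem_unitaryGroup_iff]
    constructor
    · ext a b
      fin_cases a <;> fin_cases b <;>
        simp [-Complex.ofReal_cos, -Complex.ofReal_sin, Matrix.star_apply, Matrix.mul_apply,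
          Fin.sum_univ_two] <;>
        first | ring1 | linear_combination h
    · rw [Matrix.det_fin_two_of]
      linear_combination h⟩

/-- Some matchgate circuit maps the Majorana operators of the first qubit to the combinations with
coefficients `x` and `y` of the `X`- and `Y`-type Majorana operators. -/
def Reachable {n : ℕ} (hn : 0 < n) (x y : Fin n → ℝ) : Prop :=
  ∃ U : QubitOp n, Uᴴ * U = 1 ∧ IsMatchgateCircuit U ∧
    Uᴴ * majorana (Pi.single ⟨0, hn⟩ 1) * U = majorana (fun k => (x k : ℂ)) ∧
    Uᴴ * majorana (Pi.single ⟨0, hn⟩ Complex.I) * U = majorana (fun k => Complex.I * y k)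

theorem Reachable.rotate {n : ℕ} {hn : 0 < n} {x y x' y' : Fin n → ℝ} (h : Reachable hn x y)
    {p q : Fin n} (hpq : (q : ℕ) = p + 1) (hx : x q = 0) (hy : y q = 0) (θ φ : ℝ)
    (hx' : ∀ k, k ≠ p → k ≠ q → x' k = x k) (hy' : ∀ k, k ≠ p → k ≠ q → y' k = y k)
    (hxp : x' p = x p * Real.cos θ) (hxq : x' q = x p * Real.sin θ)
    (hyp : y' p = y p * Real.cos φ) (hyq : y' q = y p * Real.sin φ) : Reachable hn x' y' := by
  obtain ⟨U, hU, ⟨gates, hgates⟩, hUx, hUy⟩ := h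
  -- Rotations by α in `A` and β in `B` turn the X-type plane by β + α and the Y-type plane by β −
  -- α; the half angles solve for θ and φ.
  let g : PlacedGate n :=
    ⟨p, hpq ▸ q.2, rotation ((θ - φ) / 2), rotation ((θ + φ) / 2)⟩
  have hg : g.toOp = onPair p q (matchgate g.A g.B) := by
    have : q = ⟨p + 1, hpq ▸ q.2⟩ := Fin.ext hpq
    rw [this]
    rfl
  have hθ : θ = (θ + φ) / 2 + (θ - φ) / 2 := by ring
  have hφ : φ = (θ + φ) / 2 - (θ - φ) / 2 := by ring
  have cosθ : (Real.cos θ : ℂ) = Real.cos ((θ + φ) / 2) * Real.cos ((θ - φ) / 2) -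
      Real.sin ((θ + φ) / 2) * Real.sin ((θ - φ) / 2) := by
    conv_lhs => rw [hθ, Real.cos_add]
    push_cast; rfl
  have sinθ : (Real.sin θ : ℂ) = Real.sin ((θ + φ) / 2) * Real.cos ((θ - φ) / 2) +
      Real.cos ((θ + φ) / 2) * Real.sin ((θ - φ) / 2) := by
    conv_lhs => rw [hθ, Real.sin_add]
    push_cast; rfl
  have cosφ : (Real.cos φ : ℂ) = Real.cos ((θ + φ) / 2) * Real.cos ((θ - φ) / 2) +
      Real.sin ((θ + φ) / 2) * Real.sin ((θ - φ) / 2) := by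
    conv_lhs => rw [hφ, Real.cos_sub]
    push_cast; rfl
  have sinφ : (Real.sin φ : ℂ) = Real.sin ((θ + φ) / 2) * Real.cos ((θ - φ) / 2) -
      Real.cos ((θ + φ) / 2) * Real.sin ((θ - φ) / 2) := by
    conv_lhs => rw [hφ, Real.sin_sub]
    push_cast; rfl
  refine ⟨U * g.toOp, ?_, ⟨gates ++ [g], by simp [hgates]⟩, ?_, ?_⟩
  · rw [Matrix.conjTranspose_mul, mul_assoc, ← mul_assoc Uᴴ, hU, one_mul, g.toOp_unitary]
  · rw [Matrix.conjTranspose_mul, mul_assoc, mul_assoc, ← mul_assoc _ U, ← mul_assoc Uᴴ,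
      ← mul_assoc Uᴴ, hUx, ← mul_assoc, hg]
    refine onPair_conj_majorana hpq _ _ _ _ (fun k h1 h2 => by rw [hx' k h1 h2]) ?_
    rw [matchgate_conj_pairMajorana, hxp, hxq, hx]
    congr 1 <;> simp only [g, rotation] <;> simp [-Complex.ofReal_cos, -Complex.ofReal_sin]
    · linear_combination (-(x p)) * cosθ
    · linear_combination (-(x p)) * sinθ
  · rw [Matrix.conjTranspose_mul, mul_assoc, mul_assoc, ← mul_assoc _ U, ← mul_assoc Uᴴ,
      ← mul_assoc Uᴴ, hUy, ← mul_assoc, hg]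
    refine onPair_conj_majorana hpq _ _ _ _ (fun k h1 h2 => by rw [hy' k h1 h2]) ?_
    rw [matchgate_conj_pairMajorana, hyp, hyq, hy]
    congr 1 <;> simp only [g, rotation] <;> simp [-Complex.ofReal_cos, -Complex.ofReal_sin]
    · linear_combination (-(Complex.I * y p)) * cosφ
    · linear_combination (-(Complex.I * y p)) * sinφ

theorem exists_polar (a b : ℝ) : ∃ r θ, 0 ≤ r ∧ r ^ 2 = a ^ 2 + b ^ 2 ∧
    a = r * Real.cos θ ∧ b = r * Real.sin θ := by
  refine ⟨‖(⟨a, b⟩ : ℂ)‖, Complex.arg ⟨a, b⟩, norm_nonneg _, ?_, ?_, ?_⟩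
  · rw [← Complex.normSq_eq_norm_sq, Complex.normSq_mk]; ring
  · rw [Complex.norm_mul_cos_arg]
  · rw [Complex.norm_mul_sin_arg]

/-- Polar coordinates merge the entries at `j` and `j + 1` into a radius at `j`, separately for `x`
and `y`. Radii are nonnegative, so the sign condition is needed only in `ih`, and the last rotation
produces any signs. -/
theorem reachable_succ {n : ℕ} (hn : 0 < n) (j : ℕ) (hj : j + 1 < n)
    (ih : ∀ x y : Fin n → ℝ, (∀ k : Fin n, j < k → x k = 0) → (∀ k : Fin n, j < k → y k = 0) →
      ∑ k, x k ^ 2 = 1 → ∑ k, y k ^ 2 = 1 → 0 ≤ x ⟨j, Nat.lt_of_succ_lt hj⟩ →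
      0 ≤ y ⟨j, Nat.lt_of_succ_lt hj⟩ → Reachable hn x y)
    (x y : Fin n → ℝ) (hx : ∀ k : Fin n, j + 1 < k → x k = 0)
    (hy : ∀ k : Fin n, j + 1 < k → y k = 0) (hx1 : ∑ k, x k ^ 2 = 1)
    (hy1 : ∑ k, y k ^ 2 = 1) : Reachable hn x y := by
  set p : Fin n := ⟨j, Nat.lt_of_succ_lt hj⟩ with hp
  set q : Fin n := ⟨j + 1, hj⟩ with hq
  have hne : p ≠ q := by simp [p, q, Fin.ext_iff]
  obtain ⟨r, θ, hr, hr2, hrc, hrs⟩ := exists_polar (x p) (x q)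
  obtain ⟨s, φ, hs, hs2, hsc, hss⟩ := exists_polar (y p) (y q)
  have supp : ∀ (u : Fin n → ℝ) (t : ℝ), (∀ k : Fin n, j + 1 < k → u k = 0) →
      ∀ k : Fin n, j < k → Function.update (Function.update u q 0) p t k = 0 := by
    intro u t hu k hk
    have h1 : k ≠ p := by rintro rfl; simp [p] at hk
    rw [Function.update_of_ne h1]
    by_cases h2 : k = q
    · rw [h2, Function.update_self]
    · rw [Function.update_of_ne h2]
      refine hu k (lt_of_le_of_ne hk fun h => h2 (Fin.ext h.symm))
  have norm : ∀ (u : Fin n → ℝ) (t : ℝ), t ^ 2 = u p ^ 2 + u q ^ 2 → ∑ k, u k ^ 2 = 1 →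
      ∑ k, Function.update (Function.update u q 0) p t k ^ 2 = 1 := by
    intro u t ht hu
    rw [sum_eq_add_add_sum_erase hne] at hu ⊢
    rw [Function.update_self, Function.update_of_ne hne.symm, Function.update_self, ht]
    rw [← hu]
    congr 1
    · ring
    · refine Finset.sum_congr rfl fun k hk => ?_
      simp only [Finset.mem_erase] at hk
      rw [Function.update_of_ne hk.2.1, Function.update_of_ne hk.1]
  refine (ih (Function.update (Function.update x q 0) p r)
    (Function.update (Function.update y q 0) p s) (supp x r hx) (supp y s hy) (norm x r hr2 hx1)
    (norm y s hs2 hy1) (by simpa using hr) (by simpa using hs)).rotate (p := p) (q := q) rfl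
    ?_ ?_ θ φ ?_ ?_ ?_ ?_ ?_ ?_
  · simp [hne.symm]
  · simp [hne.symm]
  · intro k h1 h2; simp [h1, h2]
  · intro k h1 h2; simp [h1, h2]
  · simpa using hrc
  · simpa using hrs
  · simpa using hsc
  · simpa using hss

theorem reachable_of_nonneg {n : ℕ} (hn : 0 < n) (j : ℕ) (hj : j < n) (x y : Fin n → ℝ)
    (hx : ∀ k : Fin n, j < k → x k = 0) (hy : ∀ k : Fin n, j < k → y k = 0)
    (hx1 : ∑ k, x k ^ 2 = 1) (hy1 : ∑ k, y k ^ 2 = 1) (hxj : 0 ≤ x ⟨j, hj⟩)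
    (hyj : 0 ≤ y ⟨j, hj⟩) : Reachable hn x y := by
  induction j generalizing x y with
  | zero =>
    -- The sign condition excludes −1, so the empty circuit suffices.
    have base : ∀ u : Fin n → ℝ, (∀ k : Fin n, 0 < (k : ℕ) → u k = 0) → ∑ k, u k ^ 2 = 1 →
        0 ≤ u ⟨0, hj⟩ → u = Pi.single ⟨0, hj⟩ 1 := by
      intro u hu hu1 hu0
      have hu' : ∀ k, k ≠ ⟨0, hj⟩ → u k = 0 := fun k hk =>
        hu k (Nat.pos_of_ne_zero fun h => hk (Fin.ext h))
      rw [Finset.sum_eq_single ⟨0, hj⟩ (fun k _ hk => by rw [hu' k hk]; simp) (by simp)] at hu1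
      funext k
      by_cases hk : k = ⟨0, hj⟩
      · subst hk
        rw [Pi.single_eq_same]
        exact (pow_eq_one_iff_of_nonneg hu0 two_ne_zero).1 hu1
      · rw [hu' k hk, Pi.single_eq_of_ne hk]
    rw [base x hx hx1 hxj, base y hy hy1 hyj]
    refine ⟨1, by simp, ⟨[], by simp⟩, ?_, ?_⟩
    · rw [Matrix.conjTranspose_one, one_mul, mul_one]
      congr 1
      funext k
      by_cases hk : k = ⟨0, hj⟩ <;> simp [hk]
    · rw [Matrix.conjTranspose_one, one_mul, mul_one]
      congr 1
      funext k
      by_cases hk : k = ⟨0, hj⟩ <;> simp [hk]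
  | succ j ih =>
    exact reachable_succ hn j hj (fun x y => ih (Nat.lt_of_succ_lt hj) x y) x y hx hy hx1 hy1

theorem reachable_of_unit {n : ℕ} (hn : 2 ≤ n) (x y : Fin n → ℝ) (hx : ∑ k, x k ^ 2 = 1)
    (hy : ∑ k, y k ^ 2 = 1) : Reachable (by omega) x y :=
  -- Ending with a rotation onto the last qubit avoids any sign condition; this needs two qubits.
  reachable_succ _ (n - 2) (by omega) (reachable_of_nonneg _ (n - 2) (by omega)) x y
    (fun k hk => by omega) (fun k hk => by omega) hx hy

/-! ### Factoring the ℓ¹ ball -/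

theorem exists_plane_factorization {a b s : ℝ} (h : |a| + |b| ≤ s) :
    ∃ x₀ x₁ y₀ y₁ : ℝ, x₀ ^ 2 + x₁ ^ 2 = s ∧ y₀ ^ 2 + y₁ ^ 2 = s ∧ x₀ * y₀ = a ∧ x₁ * y₁ = b := by
  have ha := abs_le.1 (le_refl |a|)
  have hb := abs_le.1 (le_refl |b|)
  rcases (show 0 ≤ s by linarith [abs_nonneg a, abs_nonneg b]).eq_or_lt with rfl | hs
  · have ha0 : a = 0 := abs_nonpos_iff.1 (by linarith [abs_nonneg b])
    have hb0 : b = 0 := abs_nonpos_iff.1 (by linarith [abs_nonneg a])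
    exact ⟨0, 0, 0, 0, by simp [ha0, hb0]⟩
  -- With unit vectors at angles α and β, scaled by √s, the requirement is cos(α − β) = (a + b)/s
  -- and cos(α + β) = (a − b)/s, so `u` = α − β and `v` = α + β.
  · set u := Real.arccos ((a + b) / s) with hu
    set v := Real.arccos ((a - b) / s) with hv
    have cu : Real.cos u = (a + b) / s := Real.cos_arccos
      (by rw [le_div_iff₀ hs]; linarith) (by rw [div_le_iff₀ hs]; linarith)
    have cv : Real.cos v = (a - b) / s := Real.cos_arccos
      (by rw [le_div_iff₀ hs]; linarith) (by rw [div_le_iff₀ hs]; linarith)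
    have eu : Real.cos u = Real.cos ((u + v) / 2) * Real.cos ((v - u) / 2) +
        Real.sin ((u + v) / 2) * Real.sin ((v - u) / 2) := by
      rw [← Real.cos_sub]; ring_nf
    have ev : Real.cos v = Real.cos ((u + v) / 2) * Real.cos ((v - u) / 2) -
        Real.sin ((u + v) / 2) * Real.sin ((v - u) / 2) := by
      rw [← Real.cos_add]; ring_nf
    rw [cu, div_eq_iff hs.ne'] at eu
    rw [cv, div_eq_iff hs.ne'] at ev
    have hsq := Real.sq_sqrt hs.le
    refine ⟨√s * Real.cos ((u + v) / 2), √s * Real.sin ((u + v) / 2),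
      √s * Real.cos ((v - u) / 2), √s * Real.sin ((v - u) / 2), ?_, ?_, ?_, ?_⟩
    · rw [mul_pow, mul_pow, ← mul_add, Real.cos_sq_add_sin_sq, hsq, mul_one]
    · rw [mul_pow, mul_pow, ← mul_add, Real.cos_sq_add_sin_sq, hsq, mul_one]
    · linear_combination (Real.cos ((u + v) / 2) * Real.cos ((v - u) / 2)) * hsq - (eu + ev) / 2
    · linear_combination (Real.sin ((u + v) / 2) * Real.sin ((v - u) / 2)) * hsq - (eu - ev) / 2

/-- A vector in the `ℓ¹` unit ball is the coordinatewise product of two unit vectors. -/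
theorem exists_unit_factorization {n : ℕ} (hn : 2 ≤ n) (a : Fin n → ℝ) (ha : ∑ k, |a k| ≤ 1) :
    ∃ x y : Fin n → ℝ, ∑ k, x k ^ 2 = 1 ∧ ∑ k, y k ^ 2 = 1 ∧ ∀ k, x k * y k = a k := by
  let p : Fin n := ⟨0, by omega⟩
  let q : Fin n := ⟨1, by omega⟩
  have hne : p ≠ q := by simp [p, q, Fin.ext_iff]
  rw [sum_eq_add_add_sum_erase hne] at ha
  -- Square roots handle the other coordinates exactly; the first two absorb the slack 1 − ‖a‖₁,
  -- which a single coordinate could not.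
  obtain ⟨x₀, x₁, y₀, y₁, hx, hy, h₀, h₁⟩ := exists_plane_factorization (le_sub_right_of_add_le ha)
  refine ⟨fun k => if k = p then x₀ else if k = q then x₁ else √|a k|,
    fun k => if k = p then y₀ else if k = q then y₁ else SignType.sign (a k) * √|a k|,
    ?_, ?_, fun k => ?_⟩
  · rw [sum_eq_add_add_sum_erase hne]
    simp only [if_true, if_neg hne.symm, hx]
    rw [sub_add, sub_eq_self, sub_eq_zero]
    refine Finset.sum_congr rfl fun k hk => ?_
    simp only [Finset.mem_erase] at hk
    rw [if_neg hk.2.1, if_neg hk.1, Real.sq_sqrt (abs_nonneg _)]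
  · rw [sum_eq_add_add_sum_erase hne]
    simp only [if_true, if_neg hne.symm, hy]
    rw [sub_add, sub_eq_self, sub_eq_zero]
    refine Finset.sum_congr rfl fun k hk => ?_
    simp only [Finset.mem_erase] at hk
    rw [if_neg hk.2.1, if_neg hk.1, mul_pow, Real.sq_sqrt (abs_nonneg _)]
    rcases lt_trichotomy (a k) 0 with h | h | h <;> simp [h]
  · dsimp only
    split_ifs with h1 h2
    · rw [h1, h₀]
    · rw [h2, h₁]
    · rw [mul_left_comm, Real.mul_self_sqrt (abs_nonneg _), sign_mul_abs]

end MatchgateLTG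

theorem mainTheorem2 (n : ℕ) (hn : 1 ≤ n) :
    (∀ U : Matrix.unitaryGroup (MatchgateLTG.BitString n) ℂ,
      MatchgateLTG.IsMatchgateCircuit (U : MatchgateLTG.QubitOp n) →
      ∃ a : Fin n → ℝ, ∑ k, |a k| ≤ 1 ∧
        ∀ x : MatchgateLTG.BitString n,
          MatchgateLTG.diagElement
            ((U : MatchgateLTG.QubitOp n)ᴴ * MatchgateLTG.pauliZ ⟨0, hn⟩ *
              (U : MatchgateLTG.QubitOp n)) x =
            ((a ⬝ᵥ MatchgateLTG.signVec x : ℝ) : ℂ)) ∧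
    (2 ≤ n → ∀ a : Fin n → ℝ, ∑ k, |a k| ≤ 1 →
      ∃ U : Matrix.unitaryGroup (MatchgateLTG.BitString n) ℂ,
        MatchgateLTG.IsMatchgateCircuit (U : MatchgateLTG.QubitOp n) ∧
        ∀ x : MatchgateLTG.BitString n,
          MatchgateLTG.diagElement
            ((U : MatchgateLTG.QubitOp n)ᴴ * MatchgateLTG.pauliZ ⟨0, hn⟩ *
              (U : MatchgateLTG.QubitOp n)) x =
            ((a ⬝ᵥ MatchgateLTG.signVec x : ℝ) : ℂ)) := by
  open MatchgateLTG in
  refine ⟨fun U hU => ?_, fun hn2 a ha => ?_⟩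
  · have hUU : (U : QubitOp n) * (U : QubitOp n)ᴴ = 1 := Matrix.mem_unitaryGroup_iff.1 U.2
    obtain ⟨z, hz⟩ := hU.exists_conj_majorana (Pi.single ⟨0, hn⟩ 1)
    obtain ⟨w, hw⟩ := hU.exists_conj_majorana (Pi.single ⟨0, hn⟩ Complex.I)
    have inner : ∀ u v : ℂ, ∑ k, (star ((Pi.single ⟨0, hn⟩ u : Fin n → ℂ) k) *
        (Pi.single ⟨0, hn⟩ v : Fin n → ℂ) k).re = (star u * v).re := by
      intro u v
      rw [Finset.sum_eq_single ⟨0, hn⟩ (fun k _ hk => by simp [Pi.single_eq_of_ne hk]) (by simp)]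
      simp
    refine ⟨fun k => (star (z k) * w k).im, sum_abs_im_le_one ?_ ?_,
      diagElement_conj_pauliZ hn hUU hz hw ?_⟩
    · rw [sum_re_eq_of_conj hUU hz hz, inner]; simp
    · rw [sum_re_eq_of_conj hUU hw hw, inner]; simp
    · rw [sum_re_eq_of_conj hUU hz hw, inner]; simp
  · obtain ⟨x, y, hx, hy, hxy⟩ := exists_unit_factorization hn2 a ha
    obtain ⟨U, hU, hcirc, hUx, hUy⟩ := reachable_of_unit hn2 x y hx hy
    refine ⟨⟨U, Matrix.mem_unitaryGroup_iff'.2 hU⟩, hcirc, fun b => ?_⟩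
    rw [diagElement_conj_pauliZ hn (mul_eq_one_comm.1 hU) hUx hUy (by simp)]
    simp [← hxy, dotProduct]
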